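/- Let $p,q\ge 0$ with $p+q=1$ and $\alpha,\beta\ge 0$. For $n\ge 0$ let $\mathcal X_n$ be the set of configurations $x=\{x_1<\dots<x_n\}$ of nonnegative integers, $\mathcal E_n=L^1(\mathcal X_n)$ (complex valued, counting measure), and $\delta_y\in\mathcal E_k$ the indicator function of $y\in\mathcal X_k$. In the ASEP on $\{0,1,2,\dots\}$ each particle jumps one step to the right at rate $p$ and, if it is not at $0$, one step to the left at rate $q$, a jump being suppressed if the target site is occupied. For $x,y\in\mathcal X_n$ let $\mathfrak p_n(x,y;t)$ be the probability that this $n$-particle process, started at $y$, is at $x$ at time $t$, and let $$\widehat{\mathfrak p}_n(x,y;s)=\int_0^\infty \mathfrak p_n(x,y;t)\,e^{-st}\,dt .$$ In the ASEP with open boundary at $0$, in addition, a particle is injected at site $0$ at rate $\alpha$ when that site is empty, and a particle at site $0$ is ejected at rate $\beta$. Let $P_n(x;t)$ be the probability that this open process is in the configuration $x\in\mathcal X_n$ at time $t$, and let $\widehat P_n(s)$ be its Laplace transform $x\mapsto\int_0^\infty P_n(x;t)\,e^{-st}\,dt$. Let $L_n(s)$ be the operator on $\mathcal E_n$ with kernel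 $\widehat{\mathfrak p}_n(x,y;s)$, let $\delta$ be multiplication by the indicator of $x_1=0$ (zero when $n=0$), let $A_n:\mathcal E_{n-1}\to\mathcal E_n$ be given by $(A_nF)(x_1,\dots,x_n)=\mathbf 1_{\{x_1=0\}}F(x_2,\dots,x_n)$ (with $A_0=0$), and let $$M_n(s)=\bigl(I-(\alpha-\beta)\,L_n(s)\,\delta\bigr)^{-1}.$$ Suppose that $\beta=0$ and that initially there are $k\ge 0$ particles, at $y\in\mathcal X_k$. Let $s\in\mathbb C$ with $\operatorname{Re}s>\alpha$. Then the Laplace integrals that define $\widehat{\mathfrak p}_n(x,z;s)$ and $\widehat P_n(s-\alpha)$ converge absolutely, $\widehat P_n(s-\alpha)\in\mathcal E_n$, the operators $L_n(s)$ are well defined and bounded on $\mathcal E_n$, the operators $I-\alpha L_n(s)\delta$ have bounded inverses $M_n(s)$ (for all $n\ge 0$), and $$\widehat P_k(s-\alpha)=M_k(s)\,L_k(s)\,\delta_y$$ (which equals $s^{-1}$ when $k=0$), and for every $n>k$ $$\widehat P_n(s-\alpha)=\alpha\,M_n(s)\,L_n(s)\,A_n\,\widehat P_{n-1}(s-\alpha).$$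 -/

import Mathlib

open scoped NNReal ENNReal

namespace OpenASEP

noncomputable section

/-! ### Continuous-time Markov chains on a countable set, given by their jump rates

A chain with jump rates `r x z` (from `x` to `z`) waits at `x` an exponential time with parameter
`exitRate r x = ∑ z, r x z` and then jumps to `z` with probability `r x z / exitRate r x`; all these
choices are made independently.  The law of the chain is the classical (Feller) one: the sum, over
the number `m` of jumps, of the probabilities `jumpProb r m t x y`. -/

/-- Total rate at which the chain leaves `x`. -/
def exitRate {X : Type} (r : X → X → ℝ≥0∞) (x : X) : ℝ≥0∞ := ∑' z, r x z

/-- Probability that the chain started at `x` makes exactly `m` jumps during `[0,t]` and is at `y`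
at time `t`.  With no jump: the holding time at `x` exceeds `t`, and `x = y`.  With `m + 1` jumps:
the first jump happens at time `u ∈ [0,t]` and leads to `z`, which has density
`exp (-exitRate r x * u) * r x z`, and the chain restarted at `z` makes exactly `m` jumps in the
remaining time `t - u` and is then at `y`. -/
def jumpProb {X : Type} [DecidableEq X] (r : X → X → ℝ≥0∞) : ℕ → ℝ → X → X → ℝ≥0∞
  | 0, t, x, y => if x = y then ENNReal.ofReal (Real.exp (-(exitRate r x).toReal * t)) else 0
  | m + 1, t, x, y =>
      ∫⁻ u in Set.Icc (0 : ℝ) t, ENNReal.ofReal (Real.exp (-(exitRate r x).toReal * u)) *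
        ∑' z, r x z * jumpProb r m (t - u) z y

/-- Probability that the chain with jump rates `r` started at `x` is at `y` at time `t ≥ 0`. -/
def transProb {X : Type} [DecidableEq X] (r : X → X → ℝ≥0∞) (t : ℝ) (x y : X) : ℝ :=
  (∑' m : ℕ, jumpProb r m t x y).toReal

/-! ### ASEP on the nonnegative integers, closed and with an open boundary at `0`

A finite configuration is the finite set of its occupied sites. -/

/-- Configurations of `n` particles. -/
abbrev Config (n : ℕ) : Type := {x : Finset ℕ // x.card = n}

/-- Rate of the jump `x → y` by the motion of one particle: a particle at `a` moves to `a + 1` with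
rate `p` if `a + 1` is empty, and, if `a ≠ 0`, to `a - 1` with rate `q` if `a - 1` is empty. -/
def hopRate (p q : ℝ≥0) (x y : Finset ℕ) : ℝ≥0∞ :=
  ∑ a ∈ x,
    ((if a + 1 ∉ x ∧ y = insert (a + 1) (x.erase a) then (p : ℝ≥0∞) else 0) +
     (if a ≠ 0 ∧ a - 1 ∉ x ∧ y = insert (a - 1) (x.erase a) then (q : ℝ≥0∞) else 0))

/-- Jump rates of ASEP with an open boundary: besides the motion of particles, a particle is
injected at `0` with rate `α` if `0` is empty, and a particle at `0` is ejected with rate `β`. -/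
def openRate (p q α β : ℝ≥0) (x y : Finset ℕ) : ℝ≥0∞ :=
  hopRate p q x y +
    (if 0 ∉ x ∧ y = insert 0 x then (α : ℝ≥0∞) else 0) +
    (if 0 ∈ x ∧ y = x.erase 0 then (β : ℝ≥0∞) else 0)

/-- Probability that closed `n`-particle ASEP, started at `y`, is at `x` at time `t`. -/
def asepProb (p q : ℝ≥0) (n : ℕ) (x y : Config n) (t : ℝ) : ℝ :=
  transProb (fun z w : Config n => hopRate p q z w) t y x

/-- Probability that ASEP with an open boundary, started at the finite configuration `y`, is at the
`n`-particle configuration `x` at time `t`. -/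
def openProb (p q α β : ℝ≥0) (y : Finset ℕ) (n : ℕ) (x : Config n) (t : ℝ) : ℝ :=
  transProb (openRate p q α β) t y x

/-! ### Laplace transforms -/

/-- The integrand of the Laplace transform of `f` at `s`. -/
def laplaceIntegrand (f : ℝ → ℝ) (s : ℂ) (t : ℝ) : ℂ := (f t : ℂ) * Complex.exp (-(s * t))

/-- The integral that defines the Laplace transform of `f` at `s` converges absolutely. -/
def LaplaceConverges (f : ℝ → ℝ) (s : ℂ) : Prop :=
  MeasureTheory.IntegrableOn (laplaceIntegrand f s) (Set.Ioi 0)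

/-- The Laplace transform of `f` at `s`. -/
def laplace (f : ℝ → ℝ) (s : ℂ) : ℂ := ∫ t in Set.Ioi (0 : ℝ), laplaceIntegrand f s t

/-! ### The spaces `L¹` of configurations, and operators between them -/

/-- Absolutely summable complex functions on the set of `n`-particle configurations. -/
abbrev E (n : ℕ) : Type := lp (fun _ : Config n => ℂ) 1

/-- A function as an element of `E n`; the value is `0` if it is not absolutely summable. -/
def toE {n : ℕ} (f : Config n → ℂ) : E n :=
  open scoped Classical in if h : Memℓp f 1 then ⟨f, h⟩ else 0

/-- The bounded operator `T` on `E n` has the kernel `K`. -/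
def HasKernel {n : ℕ} (T : E n →L[ℂ] E n) (K : Config n → Config n → ℂ) : Prop :=
  ∀ (F : E n) (x : Config n), HasSum (fun y => K x y * F y) (T F x)

/-- The bounded operator on `E n` with kernel `K`; it is `0` if there is none. -/
def kernelOp {n : ℕ} (K : Config n → Config n → ℂ) : E n →L[ℂ] E n :=
  open scoped Classical in
    if h : ∃ T : E n →L[ℂ] E n, HasKernel T K then Classical.choose h else 0

lemma summable_norm {n : ℕ} (F : E n) : Summable fun x => ‖F x‖ := by
  have h := (memℓp_gen_iff (p := 1) (by simp)).1 (lp.memℓp F)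
  simpa using h

lemma norm_eq {n : ℕ} (F : E n) : ‖F‖ = ∑' x, ‖F x‖ := by
  rw [lp.norm_eq_tsum_rpow (by simp) F]
  simp

lemma memℓp_of_summable {n : ℕ} {f : Config n → ℂ} (h : Summable fun x => ‖f x‖) :
    Memℓp f 1 := by
  refine (memℓp_gen_iff (p := 1) (by simp)).2 ?_
  simpa using h

/-- `deltaFun F x = δ(x₁) F x`: multiplication by the indicator that site `0` is occupied. -/
def deltaFun {n : ℕ} (F : Config n → ℂ) (x : Config n) : ℂ :=
  if 0 ∈ x.1 then F x else 0

lemma norm_deltaFun_le {n : ℕ} (F : Config n → ℂ) (x : Config n) : ‖deltaFun F x‖ ≤ ‖F x‖ := by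
  unfold deltaFun
  split_ifs <;> simp

lemma summable_deltaFun {n : ℕ} (F : E n) : Summable fun x => ‖deltaFun F x‖ :=
  (summable_norm F).of_nonneg_of_le (fun _ => norm_nonneg _) (norm_deltaFun_le F)

/-- The bounded operator "multiplication by `δ(x₁)`" on `E n`. -/
def deltaOp (n : ℕ) : E n →L[ℂ] E n :=
  LinearMap.mkContinuous
    { toFun := fun F => (⟨deltaFun F, memℓp_of_summable (summable_deltaFun F)⟩ : E n)
      map_add' := fun F G => by
        ext x
        simp only [deltaFun, lp.coeFn_add, Pi.add_apply]
        split_ifs <;> simp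
      map_smul' := fun c F => by
        ext x
        simp only [deltaFun, lp.coeFn_smul, Pi.smul_apply, RingHom.id_apply]
        split_ifs <;> simp }
    1 (fun F => by
      rw [one_mul, norm_eq F, norm_eq]
      exact Summable.tsum_le_tsum (norm_deltaFun_le F) (summable_deltaFun F) (summable_norm F))

/-- The configuration with the particle at `0` removed. -/
def tailConfig {n : ℕ} (x : Config n) (h : 0 ∈ x.1) : Config (n - 1) :=
  ⟨x.1.erase 0, by rw [Finset.card_erase_of_mem h, x.2]⟩

/-- `injectFun F (x₁, …, xₙ) = δ(x₁) F (x₂, …, xₙ)`. -/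
def injectFun {n : ℕ} (F : Config (n - 1) → ℂ) (x : Config n) : ℂ :=
  if h : 0 ∈ x.1 then F (tailConfig x h) else 0

lemma tailConfig_injective {n : ℕ} :
    Function.Injective fun x : {x : Config n // 0 ∈ x.1} => tailConfig x.1 x.2 := by
  rintro ⟨x, hx⟩ ⟨y, hy⟩ h
  have h' : x.1.erase 0 = y.1.erase 0 := congrArg Subtype.val h
  apply Subtype.ext
  apply Subtype.ext
  show x.1 = y.1
  rw [← Finset.insert_erase hx, ← Finset.insert_erase hy, h']

lemma norm_injectFun_eq {n : ℕ} (F : Config (n - 1) → ℂ) :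
    (fun x : Config n => ‖injectFun F x‖) =
      Set.indicator {x : Config n | 0 ∈ x.1} (fun x => ‖injectFun F x‖) := by
  funext x
  by_cases h : 0 ∈ x.1
  · rw [Set.indicator_of_mem (show x ∈ {x : Config n | 0 ∈ x.1} from h)]
  · rw [Set.indicator_of_notMem (show x ∉ {x : Config n | 0 ∈ x.1} from h)]
    simp [injectFun, h]

lemma norm_injectFun_subtype {n : ℕ} (F : Config (n - 1) → ℂ) (x : {x : Config n // 0 ∈ x.1}) :
    ‖injectFun F x.1‖ = ‖F (tailConfig x.1 x.2)‖ := by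
  simp [injectFun, x.2]

lemma summable_injectFun {n : ℕ} (F : E (n - 1)) :
    Summable fun x : Config n => ‖injectFun (n := n) F x‖ := by
  rw [norm_injectFun_eq, ← summable_subtype_iff_indicator]
  refine ((summable_norm F).comp_injective (tailConfig_injective (n := n))).congr fun x => ?_
  exact (norm_injectFun_subtype F x).symm

lemma tsum_injectFun_le {n : ℕ} (F : E (n - 1)) :
    ∑' x : Config n, ‖injectFun (n := n) F x‖ ≤ ∑' x, ‖F x‖ := by
  rw [norm_injectFun_eq, ← tsum_subtype]
  refine le_trans (le_of_eq (tsum_congr fun x => norm_injectFun_subtype F x)) ?_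
  exact Summable.tsum_le_tsum_of_inj _ (tailConfig_injective (n := n))
    (fun _ _ => norm_nonneg _) (fun _ => le_rfl)
    ((summable_norm F).comp_injective (tailConfig_injective (n := n))) (summable_norm F)

/-- The bounded operator `A n : E (n - 1) → E n`, `(A n F)(x₁, …, xₙ) = δ(x₁) F(x₂, …, xₙ)`.
In particular `A 0 = 0`. -/
def A (n : ℕ) : E (n - 1) →L[ℂ] E n :=
  LinearMap.mkContinuous
    { toFun := fun F =>
        (⟨injectFun (n := n) F, memℓp_of_summable (summable_injectFun F)⟩ : E n)
      map_add' := fun F G => by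
        ext x
        simp only [injectFun, lp.coeFn_add, Pi.add_apply]
        split_ifs <;> simp
      map_smul' := fun c F => by
        ext x
        simp only [injectFun, lp.coeFn_smul, Pi.smul_apply, RingHom.id_apply]
        split_ifs <;> simp }
    1 (fun F => by
      rw [one_mul, norm_eq F, norm_eq]
      exact tsum_injectFun_le F)

/-- Laplace transform of the transition probability of closed `n`-particle ASEP from `y` to `x`. -/
def asepKernel (p q : ℝ≥0) (n : ℕ) (s : ℂ) (x y : Config n) : ℂ :=
  laplace (asepProb p q n x y) s

/-- The operator on `E n` with kernel `asepKernel p q n s`. -/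
def L (p q : ℝ≥0) (n : ℕ) (s : ℂ) : E n →L[ℂ] E n := kernelOp (asepKernel p q n s)

/-- The operator `I - (α - β) L_n(s) δ` on `E n`. -/
def resolventOp (p q α β : ℝ≥0) (n : ℕ) (s : ℂ) : E n →L[ℂ] E n :=
  1 - ((((α : ℝ) - (β : ℝ) : ℝ)) : ℂ) • (L p q n s * deltaOp n)

/-- `M_n(s) = (I - (α - β) L_n(s) δ)⁻¹` (and `0` if that operator is not invertible). -/
def M (p q α β : ℝ≥0) (n : ℕ) (s : ℂ) : E n →L[ℂ] E n :=
  Ring.inverse (resolventOp p q α β n s)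

/-- Laplace transform of the probabilities of the `n`-particle configurations, for ASEP with an open
boundary started at `y`, as an element of `E n`. -/
def Phat (p q α β : ℝ≥0) (y : Finset ℕ) (n : ℕ) (s : ℂ) : E n :=
  toE fun x => laplace (openProb p q α β y n x) s

end

end OpenASEP

/-!
The proof takes place in the Laplace domain, where every process satisfies a linear equation.

For a chain with finite exit rates, the law defined by `jumpProb` splits a path at its first jump.
Exponential holding times commute under convolution, so by induction on the number of jumps the
path can be split at its last jump instead (`occ_succ_forward`).  Summed over the number of jumps
and written as an identity between measures on the time axis (`occMeasure_forward`), this yields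
Kolmogorov's forward equation for complex Laplace transforms (`hasSum_laplace_forward`): with
`G x y` the transform of the transition probability from `x` to `y`,
`(s + e y) * G x y = δ x y + ∑ z, r z y * G x z`.
The same first-jump recursion shows that the total discounted time is at most `1 / Re s`
(`tsum_lintegral_occMeasure_le`), which gives all convergence statements and `‖L n s‖ ≤ 1 / Re s`.

The closed `n`-particle process has exit rates bounded by `n * (p + q)`.  Hence its generator `H`
acts on `ℓ¹`, it is dissipative there, and `(s - H) F = g` has at most one solution in `ℓ¹`
(`SolvesResolvent.unique`); by the forward equation that solution is `L n s g`.

For the open process without ejection, a configuration of `n` particles has the exit rate of the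
closed process plus `α (1 - δ)`, and it can be entered from the `n - 1` particle sector only by an
injection.  The forward equation at `s - α` therefore reads
`(s - H) P̂ₙ = 1_{n = k} δ_y + α δ P̂ₙ + α Aₙ P̂ₙ₋₁` (`solvesResolvent_Phat`).  Applying `L n s` and
inverting `1 - α L n s δ`, which is possible since `α ‖L n s‖ ≤ α / Re s < 1`, gives the formulas;
the sectors with fewer than `k` particles vanish by induction on `n`.
-/

/-! ### Decomposition of a chain at its first and at its last jump -/

namespace OpenASEP

open MeasureTheory Set

variable {X : Type} [DecidableEq X] (r : X → X → ℝ≥0∞)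

/-- The exponential average `∫₀^∞ exp (-a u) f (c + u) du`, as a function of `c`. -/
noncomputable def expAvg (a : ℝ) (f : ℝ → ℝ≥0∞) (c : ℝ) : ℝ≥0∞ :=
  ∫⁻ u in Ioi (0 : ℝ), ENNReal.ofReal (Real.exp (-a * u)) * f (c + u)

lemma measurable_expAvg (a : ℝ) {f : ℝ → ℝ≥0∞} (hf : Measurable f) : Measurable (expAvg a f) := by
  unfold expAvg
  exact Measurable.lintegral_prod_right'
    (f := fun z : ℝ × ℝ => ENNReal.ofReal (Real.exp (-a * z.2)) * f (z.1 + z.2)) (by fun_prop)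

lemma expAvg_tsum {ι : Type*} [Countable ι] (a : ℝ) {f : ι → ℝ → ℝ≥0∞}
    (hf : ∀ i, Measurable (f i)) (c : ℝ) :
    expAvg a (fun u => ∑' i, f i u) c = ∑' i, expAvg a (f i) c := by
  unfold expAvg
  simp_rw [← ENNReal.tsum_mul_left]
  exact lintegral_tsum fun i => (by have := hf i; fun_prop)

lemma expAvg_const_mul (a : ℝ) (k : ℝ≥0∞) {f : ℝ → ℝ≥0∞} (hf : Measurable f) (c : ℝ) :
    expAvg a (fun u => k * f u) c = k * expAvg a f c := by
  unfold expAvg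
  rw [← lintegral_const_mul _ (by fun_prop)]
  simp_rw [mul_left_comm]

lemma expAvg_comm (a b : ℝ) {f : ℝ → ℝ≥0∞} (hf : Measurable f) (c : ℝ) :
    expAvg a (expAvg b f) c = expAvg b (expAvg a f) c := by
  unfold expAvg
  simp_rw [← lintegral_const_mul' _ _ ENNReal.ofReal_ne_top]
  rw [lintegral_lintegral_swap (by unfold Function.uncurry; fun_prop)]
  refine lintegral_congr fun u => lintegral_congr fun v => ?_
  rw [add_right_comm, mul_left_comm]

lemma lintegral_exp_neg {b : ℝ} (hb : 0 < b) :
    ∫⁻ u in Ioi (0 : ℝ), ENNReal.ofReal (Real.exp (-b * u)) = (ENNReal.ofReal b)⁻¹ := by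
  rw [← ofReal_integral_eq_lintegral_ofReal (integrableOn_exp_mul_Ioi (by linarith) 0)
    (ae_of_all _ fun _ => (Real.exp_pos _).le), integral_exp_mul_Ioi (by linarith),
    ← ENNReal.ofReal_inv_of_pos hb]
  congr 1
  simp [neg_div_neg_eq]

lemma expAvg_exp {a σ : ℝ} (h : 0 < σ + a) (c : ℝ) :
    expAvg a (fun t => ENNReal.ofReal (Real.exp (-σ * t))) c =
      (ENNReal.ofReal (σ + a))⁻¹ * ENNReal.ofReal (Real.exp (-σ * c)) := by
  unfold expAvg
  rw [← lintegral_exp_neg h, ← lintegral_mul_const' _ _ ENNReal.ofReal_ne_top]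
  refine lintegral_congr fun u => ?_
  rw [← ENNReal.ofReal_mul (Real.exp_pos _).le, ← ENNReal.ofReal_mul (Real.exp_pos _).le,
    ← Real.exp_add, ← Real.exp_add]
  ring_nf

/-- Tonelli for the convolution of two functions on the half line. -/
lemma lintegral_mul_convolution {φ a b : ℝ → ℝ≥0∞} (hφ : Measurable φ) (ha : Measurable a)
    (hb : Measurable b) :
    ∫⁻ t in Ioi (0 : ℝ), φ t * ∫⁻ u in Icc (0 : ℝ) t, a u * b (t - u) =
      ∫⁻ u in Ioi (0 : ℝ), a u * ∫⁻ t in Ioi (0 : ℝ), φ (u + t) * b t := by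
  -- The closed half line makes the shift `t ↦ t + u` exact, without exceptional null sets.
  have key : ∀ u : ℝ, ∫⁻ t, (Ici (0 : ℝ)).indicator (fun t => φ t *
      (Icc (0 : ℝ) t).indicator (fun u => a u * b (t - u)) u) t =
      (Ici (0 : ℝ)).indicator
        (fun u => a u * ∫⁻ t in Ici (0 : ℝ), φ (u + t) * b t) u := by
    intro u
    rw [← lintegral_add_right_eq_self _ u]
    by_cases hu : 0 ≤ u
    · rw [indicator_of_mem (show u ∈ Ici (0 : ℝ) from hu), ← lintegral_const_mul _ (by fun_prop),
        ← lintegral_indicator measurableSet_Ici]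
      refine lintegral_congr fun t => ?_
      by_cases ht : 0 ≤ t
      · have htu : u ≤ u + t := by linarith
        simp [indicator, hu, ht, htu, hu.trans htu, add_comm t u, mul_left_comm]
      · simp [indicator, ht]
    · rw [indicator_of_notMem (show u ∉ Ici (0 : ℝ) from hu)]
      simp [indicator, hu]
  have hm : MeasurableSet {z : ℝ × ℝ | 0 ≤ z.1 ∧ 0 ≤ z.2 ∧ z.2 ≤ z.1} :=
    (measurableSet_le measurable_const measurable_fst).inter
      ((measurableSet_le measurable_const measurable_snd).inter
        (measurableSet_le measurable_snd measurable_fst))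
  simp_rw [setLIntegral_congr Ioi_ae_eq_Ici]
  rw [← lintegral_indicator measurableSet_Ici, ← lintegral_indicator measurableSet_Ici]
  simp_rw [← key]
  rw [lintegral_lintegral_swap]
  · refine lintegral_congr fun t => ?_
    by_cases ht : 0 ≤ t
    · simp only [indicator_of_mem (show t ∈ Ici (0 : ℝ) from ht)]
      rw [← lintegral_indicator measurableSet_Icc, ← lintegral_const_mul]
      exact Measurable.indicator (by fun_prop) measurableSet_Icc
    · simp [indicator, ht]
  · refine Measurable.aemeasurable ?_
    have : Measurable ({z : ℝ × ℝ | 0 ≤ z.1 ∧ 0 ≤ z.2 ∧ z.2 ≤ z.1}.indicator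
        fun z : ℝ × ℝ => φ z.1 * (a z.2 * b (z.1 - z.2))) := Measurable.indicator (by fun_prop) hm
    convert! this.comp measurable_swap using 1
    ext ⟨u, t⟩
    by_cases ht : 0 ≤ t <;> by_cases hu : 0 ≤ u <;> by_cases hut : u ≤ t <;>
      simp [indicator, Function.uncurry, ht, hu, hut]

/-- `occ r φ m x y c` is the expectation of `∫₀^∞ φ (c + t) dt` over the times `t` at which the
chain started at `x` is at `y` after exactly `m` jumps. -/
noncomputable def occ (φ : ℝ → ℝ≥0∞) (m : ℕ) (x y : X) (c : ℝ) : ℝ≥0∞ :=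
  ∫⁻ t in Ioi (0 : ℝ), φ (c + t) * jumpProb r m t x y

variable {φ : ℝ → ℝ≥0∞}

lemma occ_zero (x y : X) (c : ℝ) :
    occ r φ 0 x y c = if x = y then expAvg (exitRate r x).toReal φ c else 0 := by
  unfold occ expAvg
  split_ifs with h
  · simp [jumpProb, h, mul_comm]
  · simp [jumpProb, h]

section Countable

variable [Countable X]

lemma measurable_jumpProb (m : ℕ) (x y : X) : Measurable fun t => jumpProb r m t x y := by
  induction m generalizing x with
  | zero =>
    simp only [jumpProb]
    split_ifs <;> fun_prop
  | succ m ih =>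
    have hm : MeasurableSet {z : ℝ × ℝ | 0 ≤ z.2 ∧ z.2 ≤ z.1} :=
      (measurableSet_le measurable_const measurable_snd).inter
        (measurableSet_le measurable_snd measurable_fst)
    have : Measurable fun z : ℝ × ℝ => ({z : ℝ × ℝ | 0 ≤ z.2 ∧ z.2 ≤ z.1}.indicator
        fun z : ℝ × ℝ => ENNReal.ofReal (Real.exp (-(exitRate r x).toReal * z.2)) *
          ∑' w, r x w * jumpProb r m (z.1 - z.2) w y) z := by
      refine Measurable.indicator ?_ hm
      refine Measurable.mul (by fun_prop) (Measurable.tsum fun w => ?_)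
      exact ((ih w).comp (measurable_fst.sub measurable_snd)).const_mul _
    convert! Measurable.lintegral_prod_right' (ν := volume) this using 2 with t
    simp only [jumpProb]
    rw [← lintegral_indicator measurableSet_Icc]
    rfl

lemma measurable_occ (hφ : Measurable φ) (m : ℕ) (x y : X) : Measurable (occ r φ m x y) := by
  have := measurable_jumpProb r m x y
  exact Measurable.lintegral_prod_right'
    (f := fun z : ℝ × ℝ => φ (z.1 + z.2) * jumpProb r m z.2 x y) (by fun_prop)

/-- Decomposition at the first jump. -/
lemma occ_succ_backward (hφ : Measurable φ) (m : ℕ) (x y : X) (c : ℝ) :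
    occ r φ (m + 1) x y c = ∑' z, r x z * expAvg (exitRate r x).toReal (occ r φ m z y) c := by
  have hb : ∀ z, Measurable fun t => jumpProb r m t z y := fun z => measurable_jumpProb r m z y
  unfold occ
  simp only [jumpProb]
  rw [lintegral_mul_convolution (φ := fun t => φ (c + t))
    (a := fun u => ENNReal.ofReal (Real.exp (-(exitRate r x).toReal * u)))
    (b := fun t => ∑' z, r x z * jumpProb r m t z y) (by fun_prop) (by fun_prop)
    (Measurable.tsum fun z => (hb z).const_mul _)]
  have h : ∀ u, ∫⁻ t in Ioi (0 : ℝ), φ (c + (u + t)) * ∑' z, r x z * jumpProb r m t z y =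
      ∑' z, r x z * occ r φ m z y (c + u) := by
    intro u
    simp_rw [← ENNReal.tsum_mul_left]
    rw [lintegral_tsum fun z => by have := hb z; fun_prop]
    refine tsum_congr fun z => ?_
    unfold occ
    rw [← lintegral_const_mul _ (by have := hb z; fun_prop)]
    simp_rw [mul_left_comm, add_assoc]
  simp_rw [h]
  have h2 := expAvg_tsum (exitRate r x).toReal
    (f := fun z v => r x z * occ r φ m z y v)
    (fun z => (measurable_occ r hφ m z y).const_mul _) c
  simp_rw [expAvg_const_mul _ _ (measurable_occ r hφ m _ y)] at h2
  exact h2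

/-- Decomposition at the last jump. -/
lemma occ_succ_forward (hφ : Measurable φ) (m : ℕ) (x y : X) (c : ℝ) :
    occ r φ (m + 1) x y c = ∑' z, r z y * expAvg (exitRate r y).toReal (occ r φ m x z) c := by
  induction m generalizing x c with
  | zero =>
    have h0 : ∀ z w : X, occ r φ 0 z w = if z = w then expAvg (exitRate r z).toReal φ else 0 := by
      intro z w; ext c; rw [occ_zero]; split_ifs <;> rfl
    rw [occ_succ_backward r hφ, tsum_eq_single y, tsum_eq_single x]
    · rw [h0, h0, if_pos rfl, if_pos rfl, expAvg_comm _ _ hφ]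
    · intro z hz
      rw [h0, if_neg hz.symm]; simp [expAvg]
    · intro z hz
      rw [h0, if_neg hz]; simp [expAvg]
  | succ m ih =>
    have hm := measurable_occ r hφ m
    have e1 : ∀ w, occ r φ (m + 1) w y =
        fun c => ∑' z, r z y * expAvg (exitRate r y).toReal (occ r φ m w z) c :=
      fun w => funext fun c => ih w c
    have e2 : ∀ z, occ r φ (m + 1) x z =
        fun c => ∑' w, r x w * expAvg (exitRate r x).toReal (occ r φ m w z) c :=
      fun z => funext fun c => occ_succ_backward r hφ m x z c
    rw [occ_succ_backward r hφ]
    simp_rw [e1, e2]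
    have hA : ∀ a w z, Measurable (expAvg a (occ r φ m w z)) :=
      fun a w z => measurable_expAvg a (hm w z)
    simp_rw [expAvg_tsum _ (fun z => (hA _ _ z).const_mul _),
      expAvg_tsum _ (fun w => (hA _ w _).const_mul _),
      expAvg_const_mul _ _ (hA _ _ _), ← ENNReal.tsum_mul_left]
    rw [ENNReal.tsum_comm]
    refine tsum_congr fun z => tsum_congr fun w => ?_
    rw [expAvg_comm _ _ (hm w z), mul_left_comm]

variable {r}

/-- The time spent with fewer than `M` jumps behind, discounted at rate `σ`, is at most `1 / σ`:
by the first-jump recursion the bound is preserved because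
`(1 + e / σ) / (σ + e) = 1 / σ` for the exit rate `e`. -/
lemma sum_occ_exp_le (he : ∀ x, exitRate r x ≠ ∞) {σ : ℝ} (hσ : 0 < σ) (M : ℕ) (x : X) (c : ℝ) :
    ∑' y, ∑ m ∈ Finset.range M, occ r (fun t => ENNReal.ofReal (Real.exp (-σ * t))) m x y c ≤
      (ENNReal.ofReal σ)⁻¹ * ENNReal.ofReal (Real.exp (-σ * c)) := by
  set φ : ℝ → ℝ≥0∞ := fun t => ENNReal.ofReal (Real.exp (-σ * t)) with hφ_def
  have hφ : Measurable φ := by fun_prop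
  induction M generalizing x c with
  | zero => simp
  | succ M ih =>
    set a := (exitRate r x).toReal with ha
    have ha0 : 0 ≤ a := ENNReal.toReal_nonneg
    have hpos : 0 < σ + a := by positivity
    have hmS : ∀ z, Measurable fun c => ∑' y, ∑ m ∈ Finset.range M, occ r φ m z y c := fun z =>
      Measurable.tsum fun y => Finset.measurable_sum _ fun m _ => measurable_occ r hφ m z y
    have h1 : ∑' y, ∑ m ∈ Finset.range M, occ r φ (m + 1) x y c =
        ∑' z, r x z * expAvg a (fun c => ∑' y, ∑ m ∈ Finset.range M, occ r φ m z y c) c := by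
      simp_rw [occ_succ_backward r hφ]
      have : ∀ z, expAvg a (fun c => ∑' y, ∑ m ∈ Finset.range M, occ r φ m z y c) c =
          ∑' y, ∑ m ∈ Finset.range M, expAvg a (occ r φ m z y) c := by
        intro z
        rw [expAvg_tsum _ fun y => Finset.measurable_sum _ fun m _ => measurable_occ r hφ m z y]
        refine tsum_congr fun y => ?_
        unfold expAvg
        simp_rw [Finset.mul_sum]
        exact lintegral_finsetSum _ fun m _ => by have := measurable_occ r hφ m z y; fun_prop
      simp_rw [this, ← ENNReal.tsum_mul_left]
      rw [ENNReal.tsum_comm]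
      refine tsum_congr fun y => ?_
      simp_rw [Finset.mul_sum]
      rw [Summable.tsum_finsetSum fun _ _ => ENNReal.summable]
    have h2 : ∀ z, expAvg a (fun c => ∑' y, ∑ m ∈ Finset.range M, occ r φ m z y c) c ≤
        (ENNReal.ofReal σ)⁻¹ * ((ENNReal.ofReal (σ + a))⁻¹ * φ c) := by
      intro z
      rw [← expAvg_exp hpos, ← expAvg_const_mul _ _ hφ]
      unfold expAvg
      gcongr
      exact ih z _
    have h3 : ∑' y, occ r φ 0 x y c = (ENNReal.ofReal (σ + a))⁻¹ * φ c := by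
      rw [tsum_eq_single x fun y hy => by rw [occ_zero, if_neg hy.symm], occ_zero, if_pos rfl,
        expAvg_exp hpos]
    simp_rw [Finset.sum_range_succ' _ M]
    rw [ENNReal.tsum_add, h1, h3]
    calc _ ≤ (∑' z, r x z * ((ENNReal.ofReal σ)⁻¹ * ((ENNReal.ofReal (σ + a))⁻¹ * φ c))) +
          (ENNReal.ofReal (σ + a))⁻¹ * φ c := by gcongr with z; exact h2 z
      _ = (ENNReal.ofReal a * (ENNReal.ofReal σ)⁻¹ + 1) * (ENNReal.ofReal (σ + a))⁻¹ * φ c := by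
        rw [ENNReal.tsum_mul_right, ha, ENNReal.ofReal_toReal (he x)]
        unfold exitRate
        ring
      _ = (ENNReal.ofReal σ)⁻¹ * φ c := by
        congr 1
        rw [← ENNReal.ofReal_inv_of_pos hσ, ← ENNReal.ofReal_inv_of_pos hpos,
          ← ENNReal.ofReal_one, ← ENNReal.ofReal_mul ha0, ← ENNReal.ofReal_add (by positivity)
          zero_le_one, ← ENNReal.ofReal_mul (by positivity)]
        congr 1
        field_simp
        ring

end Countable

end OpenASEP

/-! ### The forward equation for Laplace transforms -/

namespace OpenASEP

open MeasureTheory Set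

variable {X : Type} [DecidableEq X] (r : X → X → ℝ≥0∞)

/-- The measure on times with density `t ↦` probability of being at `y` at time `t > 0`, for the
chain started at `x`. -/
noncomputable def occMeasure (x y : X) : Measure ℝ :=
  (volume.restrict (Ioi 0)).withDensity fun t => ∑' m, jumpProb r m t x y

/-- The measure with density `exp (-a t)` on `t > 0`. -/
noncomputable def expMeasure (a : ℝ) : Measure ℝ :=
  (volume.restrict (Ioi 0)).withDensity fun t => ENNReal.ofReal (Real.exp (-a * t))

instance (x y : X) : SFinite (occMeasure r x y) := by unfold occMeasure; infer_instance

instance (a : ℝ) : SFinite (expMeasure a) := by unfold expMeasure; infer_instance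

lemma lintegral_expMeasure (a : ℝ) {φ : ℝ → ℝ≥0∞} (hφ : Measurable φ) :
    ∫⁻ t, φ t ∂expMeasure a = expAvg a φ 0 := by
  unfold expMeasure expAvg
  rw [lintegral_withDensity_eq_lintegral_mul _ (by fun_prop) hφ]
  simp

lemma laplaceIntegrand_transProb (s : ℂ) (x y : X) (t : ℝ) :
    laplaceIntegrand (fun t => transProb r t x y) s t =
      (∑' m, jumpProb r m t x y).toReal • Complex.exp (-(s * t)) := by
  simp [laplaceIntegrand, transProb]

variable [Countable X]

lemma measurable_tsum_jumpProb (x y : X) : Measurable fun t => ∑' m, jumpProb r m t x y :=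
  Measurable.tsum fun m => measurable_jumpProb r m x y

lemma lintegral_occMeasure {φ : ℝ → ℝ≥0∞} (hφ : Measurable φ) (x y : X) (c : ℝ) :
    ∫⁻ t, φ (c + t) ∂occMeasure r x y = ∑' m, occ r φ m x y c := by
  unfold occMeasure occ
  rw [lintegral_withDensity_eq_lintegral_mul _ (measurable_tsum_jumpProb r x y) (by fun_prop)]
  simp_rw [Pi.mul_apply, ← ENNReal.tsum_mul_right]
  rw [lintegral_tsum fun m => by have := measurable_jumpProb r m x y; fun_prop]
  simp_rw [mul_comm]

/-- Kolmogorov's forward equation, integrated: decomposition at the last jump. -/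
lemma occMeasure_forward (x y : X) :
    occMeasure r x y = (if x = y then expMeasure (exitRate r y).toReal else 0) +
      Measure.sum fun z => r z y • (expMeasure (exitRate r y).toReal).conv (occMeasure r x z) := by
  refine Measure.ext_of_lintegral _ fun φ hφ => ?_
  have h0 := lintegral_occMeasure r hφ x y 0
  simp only [zero_add] at h0
  rw [h0, tsum_eq_zero_add' ENNReal.summable, lintegral_add_measure, lintegral_sum_measure]
  congr 1
  · rw [occ_zero]
    split_ifs with h
    · rw [lintegral_expMeasure _ hφ, h]
    · simp
  · simp_rw [lintegral_smul_measure, smul_eq_mul, Measure.lintegral_conv hφ,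
      lintegral_occMeasure r hφ]
    rw [tsum_congr fun m => occ_succ_forward r hφ m x y 0, ENNReal.tsum_comm]
    refine tsum_congr fun z => ?_
    rw [ENNReal.tsum_mul_left, lintegral_expMeasure _
      (Measurable.tsum fun m => measurable_occ r hφ m x z),
      expAvg_tsum _ fun m => measurable_occ r hφ m x z]

variable {r}

/-- The total discounted time spent at all states is at most `1 / σ`. -/
lemma tsum_lintegral_occMeasure_le (he : ∀ x, exitRate r x ≠ ∞) {σ : ℝ} (hσ : 0 < σ) (x : X) :
    ∑' y, ∫⁻ t, ENNReal.ofReal (Real.exp (-σ * t)) ∂occMeasure r x y ≤ (ENNReal.ofReal σ)⁻¹ := by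
  have h : ∀ y, ∫⁻ t, ENNReal.ofReal (Real.exp (-σ * t)) ∂occMeasure r x y =
      ∑' m, occ r (fun t => ENNReal.ofReal (Real.exp (-σ * t))) m x y 0 := by
    intro y
    rw [← lintegral_occMeasure r (by fun_prop)]
    simp
  simp_rw [h]
  rw [ENNReal.tsum_comm, ENNReal.tsum_eq_iSup_nat]
  refine iSup_le fun M => ?_
  rw [← Summable.tsum_finsetSum fun _ _ => ENNReal.summable]
  simpa using sum_occ_exp_le he hσ M x 0

lemma lintegral_occMeasure_lt_top (he : ∀ x, exitRate r x ≠ ∞) {σ : ℝ} (hσ : 0 < σ) (x y : X) :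
    ∫⁻ t, ENNReal.ofReal (Real.exp (-σ * t)) ∂occMeasure r x y < ∞ :=
  ((ENNReal.le_tsum y).trans (tsum_lintegral_occMeasure_le he hσ x)).trans_lt
    (ENNReal.inv_lt_top.2 (ENNReal.ofReal_pos.2 hσ))

/-- Finiteness for almost every time, so that `transProb` does not take the junk value of
`ENNReal.toReal` at `∞`. -/
lemma ae_tsum_jumpProb_lt_top (he : ∀ x, exitRate r x ≠ ∞) (x y : X) :
    ∀ᵐ t ∂volume.restrict (Ioi (0 : ℝ)), ∑' m, jumpProb r m t x y < ∞ := by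
  have h := lintegral_occMeasure_lt_top he one_pos x y
  have hm := measurable_tsum_jumpProb r x y
  unfold occMeasure at h
  rw [lintegral_withDensity_eq_lintegral_mul _ hm (by fun_prop)] at h
  filter_upwards [ae_lt_top (by fun_prop) h.ne] with t ht
  exact ENNReal.lt_top_of_mul_ne_top_left ht.ne
    (ENNReal.ofReal_pos.2 (Real.exp_pos _)).ne'

lemma enorm_cexp (s : ℂ) (t : ℝ) :
    ‖Complex.exp (-(s * t))‖ₑ = ENNReal.ofReal (Real.exp (-s.re * t)) := by
  rw [← ofReal_norm, Complex.norm_exp]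
  simp

lemma integrable_occMeasure (he : ∀ x, exitRate r x ≠ ∞) {s : ℂ} (hs : 0 < s.re) (x y : X) :
    Integrable (fun t : ℝ => Complex.exp (-(s * t))) (occMeasure r x y) := by
  refine ⟨by fun_prop, ?_⟩
  unfold HasFiniteIntegral
  simp_rw [enorm_cexp]
  exact lintegral_occMeasure_lt_top he hs x y

theorem laplaceConverges_transProb (he : ∀ x, exitRate r x ≠ ∞) {s : ℂ} (hs : 0 < s.re) (x y : X) :
    LaplaceConverges (fun t => transProb r t x y) s := by
  have h := (integrable_withDensity_iff_integrable_smul' (measurable_tsum_jumpProb r x y)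
    (ae_tsum_jumpProb_lt_top he x y)).1 (integrable_occMeasure he hs x y)
  unfold LaplaceConverges IntegrableOn
  simpa only [← laplaceIntegrand_transProb r] using h

lemma laplace_transProb (he : ∀ x, exitRate r x ≠ ∞) (s : ℂ) (x y : X) :
    laplace (fun t => transProb r t x y) s =
      ∫ t : ℝ, Complex.exp (-(s * t)) ∂occMeasure r x y := by
  unfold occMeasure laplace
  rw [integral_withDensity_eq_integral_toReal_smul (measurable_tsum_jumpProb r x y)
    (ae_tsum_jumpProb_lt_top he x y)]
  simp_rw [laplaceIntegrand_transProb r]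

/-- The Laplace transforms of the transition probabilities out of `x` have `ℓ¹` norm at most
`1 / Re s`. -/
theorem tsum_enorm_laplace_transProb_le (he : ∀ x, exitRate r x ≠ ∞) {s : ℂ} (hs : 0 < s.re)
    (x : X) :
    ∑' y, ‖laplace (fun t => transProb r t x y) s‖ₑ ≤ (ENNReal.ofReal s.re)⁻¹ := by
  refine le_trans (ENNReal.tsum_le_tsum fun y => ?_) (tsum_lintegral_occMeasure_le he hs x)
  rw [laplace_transProb he]
  refine (enorm_integral_le_lintegral_enorm _).trans_eq ?_
  simp_rw [enorm_cexp]

lemma integral_expMeasure {s : ℂ} (hs : 0 < s.re) {a : ℝ} (ha : 0 ≤ a) :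
    ∫ t : ℝ, Complex.exp (-(s * t)) ∂expMeasure a = (s + a)⁻¹ := by
  unfold expMeasure
  rw [integral_withDensity_eq_integral_toReal_smul (by fun_prop) (by simp)]
  have h : ∀ t : ℝ, (ENNReal.ofReal (Real.exp (-a * t))).toReal • Complex.exp (-(s * t)) =
      Complex.exp (-(s + a) * t) := by
    intro t
    rw [ENNReal.toReal_ofReal (Real.exp_pos _).le, Complex.real_smul, Complex.ofReal_exp,
      ← Complex.exp_add]
    push_cast
    ring_nf
  simp_rw [h]
  rw [integral_exp_mul_complex_Ioi (by simp; linarith)]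
  rw [Complex.ofReal_zero, mul_zero, Complex.exp_zero, neg_div_neg_eq, one_div]

lemma integral_cexp_conv (s : ℂ) (μ ν : Measure ℝ) [SFinite μ] [SFinite ν] :
    ∫ t : ℝ, Complex.exp (-(s * t)) ∂μ.conv ν =
      (∫ t : ℝ, Complex.exp (-(s * t)) ∂μ) * ∫ t : ℝ, Complex.exp (-(s * t)) ∂ν := by
  unfold Measure.conv
  rw [integral_map (by fun_prop) (by fun_prop), ← integral_prod_mul]
  refine integral_congr_ae (ae_of_all _ fun z => ?_)
  simp only [← Complex.exp_add]
  push_cast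
  ring_nf

/-- Kolmogorov's forward equation for the Laplace transforms of the transition probabilities. -/
theorem hasSum_laplace_forward (he : ∀ x, exitRate r x ≠ ∞) {s : ℂ} (hs : 0 < s.re) (x y : X) :
    HasSum (fun z => ((r z y).toReal : ℂ) * laplace (fun t => transProb r t x z) s)
      ((s + (exitRate r y).toReal) * laplace (fun t => transProb r t x y) s -
        if x = y then 1 else 0) := by
  set a := (exitRate r y).toReal with ha
  have ha0 : 0 ≤ a := ENNReal.toReal_nonneg
  have hsa : s + a ≠ 0 := by
    intro h
    have := congrArg Complex.re h
    simp at this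
    linarith
  have hint := integrable_occMeasure he hs x y
  rw [occMeasure_forward, integrable_add_measure] at hint
  have hsum := (hasSum_integral_measure hint.2).mul_left (s + a)
  have hI : ∫ t : ℝ, Complex.exp (-(s * t)) ∂occMeasure r x y =
      (if x = y then (s + a)⁻¹ else 0) + ∫ t : ℝ, Complex.exp (-(s * t)) ∂(Measure.sum fun z =>
        r z y • (expMeasure (exitRate r y).toReal).conv (occMeasure r x z)) := by
    rw [occMeasure_forward, integral_add_measure hint.1 hint.2]
    congr 1
    split_ifs with h
    · exact integral_expMeasure hs ha0
    · simp
  convert! hsum using 1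
  · ext z
    rw [integral_smul_measure, integral_cexp_conv, integral_expMeasure hs ha0,
      ← laplace_transProb he, Complex.real_smul]
    field_simp
  · rw [laplace_transProb he, hI, mul_add]
    split_ifs with h <;> field_simp <;> ring

end OpenASEP

/-! ### Kernels and the resolvent equation on `ℓ¹` -/

namespace OpenASEP

variable {n : ℕ}

lemma tsum_enorm_coe (F : E n) : ∑' x, ‖F x‖ₑ = ‖F‖ₑ := by
  rw [← ofReal_norm, norm_eq, ENNReal.ofReal_tsum_of_nonneg (fun _ => norm_nonneg _)
    (summable_norm F)]
  simp_rw [ofReal_norm]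

lemma memℓp_of_tsum_enorm {f : Config n → ℂ} (h : ∑' x, ‖f x‖ₑ ≠ ∞) : Memℓp f 1 :=
  memℓp_of_summable (tsum_enorm_ne_top_iff_summable_norm.1 h)

lemma toE_apply {f : Config n → ℂ} (h : ∑' x, ‖f x‖ₑ ≠ ∞) (x : Config n) : toE f x = f x := by
  unfold toE
  rw [dif_pos (memℓp_of_tsum_enorm h)]

section Kernel

variable {K : Config n → Config n → ℂ} {C : ℝ≥0∞}

lemma tsum_tsum_enorm_kernel_le (hK : ∀ y, ∑' x, ‖K x y‖ₑ ≤ C) (F : E n) :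
    ∑' x, ∑' y, ‖K x y * F y‖ₑ ≤ C * ‖F‖ₑ := by
  rw [ENNReal.tsum_comm, ← tsum_enorm_coe F, ← ENNReal.tsum_mul_left]
  gcongr with y
  simp_rw [enorm_mul]
  rw [ENNReal.tsum_mul_right]
  gcongr
  exact hK y

lemma summable_kernel (hC : C ≠ ∞) (hK : ∀ y, ∑' x, ‖K x y‖ₑ ≤ C) (F : E n) (x : Config n) :
    Summable fun y => K x y * F y := by
  refine Summable.of_norm (tsum_enorm_ne_top_iff_summable_norm.1 (ne_top_of_le_ne_top
    (ENNReal.mul_ne_top hC enorm_ne_top) ((ENNReal.le_tsum x).trans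
      (tsum_tsum_enorm_kernel_le hK F))))

lemma tsum_enorm_tsum_kernel_le (hK : ∀ y, ∑' x, ‖K x y‖ₑ ≤ C) (F : E n) :
    ∑' x, ‖∑' y, K x y * F y‖ₑ ≤ C * ‖F‖ₑ :=
  (ENNReal.tsum_le_tsum fun _ => enorm_tsum_le_tsum_enorm).trans (tsum_tsum_enorm_kernel_le hK F)

/-- Schur's test on `ℓ¹`: a kernel with uniformly summable columns defines a bounded operator. -/
lemma exists_hasKernel (hC : C ≠ ∞) (hK : ∀ y, ∑' x, ‖K x y‖ₑ ≤ C) :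
    ∃ T : E n →L[ℂ] E n, HasKernel T K := by
  have hs := summable_kernel hC hK
  have hmem : ∀ F : E n, Memℓp (fun x => ∑' y, K x y * F y) 1 := fun F =>
    memℓp_of_tsum_enorm (ne_top_of_le_ne_top (ENNReal.mul_ne_top hC enorm_ne_top)
      (tsum_enorm_tsum_kernel_le hK F))
  refine ⟨LinearMap.mkContinuous
    { toFun := fun F => (⟨_, hmem F⟩ : E n)
      map_add' := fun F G => ?_
      map_smul' := fun c F => ?_ } C.toReal fun F => ?_, fun F x => (hs F x).hasSum⟩
  · ext x
    simp only [lp.coeFn_add, Pi.add_apply, mul_add]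
    exact (hs F x).tsum_add (hs G x)
  · ext x
    simp only [lp.coeFn_smul, Pi.smul_apply, RingHom.id_apply, smul_eq_mul, mul_left_comm _ c]
    exact tsum_mul_left
  · have h := tsum_enorm_tsum_kernel_le hK F
    rw [← toReal_enorm F, ← ENNReal.toReal_mul, ← toReal_enorm]
    refine ENNReal.toReal_mono (ENNReal.mul_ne_top hC enorm_ne_top) ?_
    rw [← tsum_enorm_coe]
    exact h

lemma HasKernel.norm_le {T : E n →L[ℂ] E n} (hT : HasKernel T K) (hC : C ≠ ∞)
    (hK : ∀ y, ∑' x, ‖K x y‖ₑ ≤ C) : ‖T‖ ≤ C.toReal := by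
  refine T.opNorm_le_bound ENNReal.toReal_nonneg fun F => ?_
  rw [← toReal_enorm F, ← ENNReal.toReal_mul, ← toReal_enorm]
  refine ENNReal.toReal_mono (ENNReal.mul_ne_top hC enorm_ne_top) ?_
  rw [← tsum_enorm_coe]
  simp_rw [← (hT F _).tsum_eq]
  exact tsum_enorm_tsum_kernel_le hK F

lemma hasKernel_kernelOp (hC : C ≠ ∞) (hK : ∀ y, ∑' x, ‖K x y‖ₑ ≤ C) :
    HasKernel (kernelOp K) K := by
  have h := exists_hasKernel hC hK
  unfold kernelOp
  rw [dif_pos h]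
  exact Classical.choose_spec h

end Kernel

section Resolvent

variable (r : Config n → Config n → ℝ≥0∞) (s : ℂ)

/-- `F` solves the resolvent equation `(s - H) F = g`, where `H` is the generator
`(H F)(x) = ∑ z, r z x * F z - exitRate r x * F x` of the chain, acting on `ℓ¹`. -/
def SolvesResolvent (F g : Config n → ℂ) : Prop :=
  ∀ x, HasSum (fun z => ((r z x).toReal : ℂ) * F z) ((s + (exitRate r x).toReal) * F x - g x)

variable {r s} {C : ℝ≥0∞}

lemma SolvesResolvent.sub {F F' g : Config n → ℂ} (h : SolvesResolvent r s F g)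
    (h' : SolvesResolvent r s F' g) : SolvesResolvent r s (F - F') 0 := by
  intro x
  convert! (h x).sub (h' x) using 1
  · ext z
    simp [mul_sub]
  · simp only [Pi.sub_apply, Pi.zero_apply]
    ring

lemma rate_le (hr : ∀ x, exitRate r x ≤ C) (x z : Config n) : r x z ≤ C :=
  (ENNReal.le_tsum z).trans (hr x)

/-- The generator is dissipative: `(s - H) F = 0` gives `Re s * ‖F‖ ≤ 0`. -/
lemma SolvesResolvent.eq_zero (hC : C ≠ ∞) (hr : ∀ x, exitRate r x ≤ C) (hs : 0 < s.re)
    {F : Config n → ℂ} (hF : ∑' x, ‖F x‖ₑ ≠ ∞) (h : SolvesResolvent r s F 0) (x : Config n) :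
    F x = 0 := by
  have h1 : ∀ x, (ENNReal.ofReal s.re + exitRate r x) * ‖F x‖ₑ ≤ ∑' z, r z x * ‖F z‖ₑ := by
    intro x
    have he : ENNReal.ofReal (exitRate r x).toReal = exitRate r x :=
      ENNReal.ofReal_toReal (ne_top_of_le_ne_top hC (hr x))
    have hle : ENNReal.ofReal s.re + exitRate r x ≤ ‖s + ((exitRate r x).toReal : ℂ)‖ₑ := by
      rw [← he, ENNReal.toReal_ofReal ENNReal.toReal_nonneg, ← ENNReal.ofReal_add hs.le
        ENNReal.toReal_nonneg, ← ofReal_norm]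
      refine ENNReal.ofReal_le_ofReal ?_
      simpa using Complex.re_le_norm (s + ((exitRate r x).toReal : ℂ))
    calc _ ≤ ‖s + ((exitRate r x).toReal : ℂ)‖ₑ * ‖F x‖ₑ := by gcongr
      _ = ‖∑' z, ((r z x).toReal : ℂ) * F z‖ₑ := by
        rw [(h x).tsum_eq, ← enorm_mul, Pi.zero_apply, sub_zero]
      _ ≤ ∑' z, ‖((r z x).toReal : ℂ) * F z‖ₑ := enorm_tsum_le_tsum_enorm
      _ = ∑' z, r z x * ‖F z‖ₑ := by
        refine tsum_congr fun z => ?_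
        rw [enorm_mul, ← ofReal_norm, Complex.norm_real, Real.norm_of_nonneg
          ENNReal.toReal_nonneg, ENNReal.ofReal_toReal (ne_top_of_le_ne_top hC (rate_le hr z x))]
  have h2 := ENNReal.tsum_le_tsum h1
  rw [ENNReal.tsum_comm] at h2
  simp_rw [ENNReal.tsum_mul_right, add_mul] at h2
  rw [ENNReal.tsum_add, ENNReal.tsum_mul_left] at h2
  have h3 : ∑' x, exitRate r x * ‖F x‖ₑ ≠ ∞ := by
    refine ne_top_of_le_ne_top (ENNReal.mul_ne_top hC hF) ?_
    rw [← ENNReal.tsum_mul_left]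
    gcongr with x
    exact hr x
  have h4 : ENNReal.ofReal s.re * ∑' x, ‖F x‖ₑ = 0 := by
    have := ENNReal.le_sub_of_add_le_right h3 h2
    exact le_antisymm (this.trans_eq (tsub_self _)) bot_le
  have h5 := (mul_eq_zero.1 h4).resolve_left (ENNReal.ofReal_pos.2 hs).ne'
  exact enorm_eq_zero.1 (ENNReal.tsum_eq_zero.1 h5 x)

lemma SolvesResolvent.unique (hC : C ≠ ∞) (hr : ∀ x, exitRate r x ≤ C) (hs : 0 < s.re)
    {F F' : E n} {g : Config n → ℂ} (h : SolvesResolvent r s F g)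
    (h' : SolvesResolvent r s F' g) : F = F' := by
  rw [← sub_eq_zero]
  ext x
  refine SolvesResolvent.eq_zero hC hr hs ?_ (h.sub h') x
  rw [← lp.coeFn_sub, tsum_enorm_coe]
  exact enorm_ne_top

/-- Superposition: an operator whose columns solve the resolvent equation with unit sources is a
right inverse of `s - H`. -/
lemma HasKernel.solvesResolvent {G : Config n → Config n → ℂ} {T : E n →L[ℂ] E n} {D : ℝ≥0∞}
    (hT : HasKernel T G) (hD : D ≠ ∞) (hG : ∀ y, ∑' x, ‖G x y‖ₑ ≤ D) (hC : C ≠ ∞)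
    (hr : ∀ x, exitRate r x ≤ C)
    (h : ∀ y, SolvesResolvent r s (fun x => G x y) fun x => if y = x then 1 else 0) (F : E n) :
    SolvesResolvent r s (T F) F := by
  intro x
  have hsum : Summable fun w : Config n × Config n =>
      ((r w.1 x).toReal : ℂ) * (G w.1 w.2 * F w.2) := by
    refine Summable.of_norm (tsum_enorm_ne_top_iff_summable_norm.1 ?_)
    rw [ENNReal.tsum_prod']
    refine ne_top_of_le_ne_top (ENNReal.mul_ne_top hC (ENNReal.mul_ne_top hD
      (enorm_ne_top (x := F)))) ?_
    refine le_trans ?_ (mul_le_mul_right (tsum_tsum_enorm_kernel_le hG F) C)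
    simp_rw [← ENNReal.tsum_mul_left]
    refine ENNReal.tsum_le_tsum fun z => ENNReal.tsum_le_tsum fun y => ?_
    rw [enorm_mul]
    gcongr
    rw [← ofReal_norm, Complex.norm_real, Real.norm_of_nonneg ENNReal.toReal_nonneg]
    exact ENNReal.ofReal_toReal_le.trans (rate_le hr z x)
  have h1 := hsum.hasSum.prod_fiberwise fun z => (hT F z).mul_left ((r z x).toReal : ℂ)
  have hsw := (Equiv.prodComm (Config n) (Config n)).hasSum_iff.2 hsum.hasSum
  have h2 := hsw.prod_fiberwise (g := fun y => ((s + (exitRate r x).toReal) * G x y -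
    if y = x then 1 else 0) * F y) fun y => by
      simpa [Function.comp_def, mul_assoc] using (h y x).mul_right (F y)
  have h3 : HasSum (fun y => ((s + (exitRate r x).toReal) * G x y - if y = x then 1 else 0) * F y)
      ((s + (exitRate r x).toReal) * T F x - F x) := by
    have h4 := hasSum_single (f := fun y => (if y = x then (1 : ℂ) else 0) * F y) x
      fun y hy => by simp [hy]
    rw [if_pos rfl, one_mul] at h4
    convert! ((hT F x).mul_left (s + ((exitRate r x).toReal : ℂ))).sub h4 using 1
    ext y
    ring
  rw [h3.unique h2]
  exact h1

end Resolvent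

end OpenASEP

/-! ### Closed and open ASEP -/

namespace OpenASEP

variable (p q α : ℝ≥0) {n : ℕ}

lemma card_eq_of_hopRate_ne_zero {x w : Finset ℕ} (h : hopRate p q x w ≠ 0) :
    w.card = x.card := by
  obtain ⟨a, ha, hne⟩ := Finset.exists_ne_zero_of_sum_ne_zero h
  have key : ∀ b, b ∉ x → w = insert b (x.erase a) → w.card = x.card := by
    rintro b hb rfl
    rw [Finset.card_insert_of_notMem fun h => hb (Finset.mem_of_mem_erase h),
      Finset.card_erase_add_one ha]
  by_contra hcard
  refine hne ?_
  rw [if_neg fun h => hcard (key _ h.1 h.2), if_neg fun h => hcard (key _ h.2.1 h.2.2), add_zero]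

lemma tsum_hopRate_le (x : Finset ℕ) : ∑' w, hopRate p q x w ≤ x.card * (p + q) := by
  have key : ∀ (P : Prop) [Decidable P] (v : Finset ℕ) (c : ℝ≥0∞),
      ∑' w, (if P ∧ w = v then c else 0) ≤ c := by
    intro P _ v c
    rw [tsum_eq_single v fun w hw => if_neg fun h => hw h.2]
    split_ifs
    exacts [le_rfl, bot_le]
  unfold hopRate
  rw [Summable.tsum_finsetSum fun _ _ => ENNReal.summable, ← nsmul_eq_mul]
  refine Finset.sum_le_card_nsmul _ _ _ fun a _ => ?_
  rw [ENNReal.tsum_add]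
  gcongr
  · exact key _ _ _
  · simp_rw [← and_assoc]
    exact key _ _ _

/-- The rates of the closed `n`-particle process. -/
noncomputable abbrev hopConfig (n : ℕ) (z w : Config n) : ℝ≥0∞ := hopRate p q z w

lemma exitRate_hopConfig (x : Config n) :
    exitRate (hopConfig p q n) x = ∑' w, hopRate p q x w := by
  refine tsum_subtype_eq_of_support_subset (f := fun w => hopRate p q x w)
    (s := {w : Finset ℕ | w.card = n}) fun w hw => ?_
  exact (card_eq_of_hopRate_ne_zero p q hw).trans x.2

lemma exitRate_hopConfig_le (x : Config n) : exitRate (hopConfig p q n) x ≤ n * (p + q) := by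
  rw [exitRate_hopConfig]
  simpa only [x.2] using tsum_hopRate_le p q x

lemma card_mul_rate_ne_top (m : ℕ) : (m * (p + q) : ℝ≥0∞) ≠ ∞ :=
  ENNReal.mul_ne_top (ENNReal.natCast_ne_top m) (by simp)

lemma exitRate_hopConfig_ne_top (x : Config n) : exitRate (hopConfig p q n) x ≠ ∞ :=
  ne_top_of_le_ne_top (card_mul_rate_ne_top p q n) (exitRate_hopConfig_le p q x)

lemma openRate_zero (x w : Finset ℕ) :
    openRate p q α 0 x w = hopRate p q x w + if 0 ∉ x ∧ w = insert 0 x then (α : ℝ≥0∞) else 0 := by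
  simp [openRate]

lemma exitRate_openRate (x : Finset ℕ) :
    exitRate (openRate p q α 0) x = ∑' w, hopRate p q x w + if 0 ∉ x then (α : ℝ≥0∞) else 0 := by
  unfold exitRate
  simp_rw [openRate_zero]
  rw [ENNReal.tsum_add, tsum_eq_single (insert 0 x) fun w hw => if_neg fun h => hw h.2]
  simp

lemma exitRate_openRate_ne_top (x : Finset ℕ) : exitRate (openRate p q α 0) x ≠ ∞ := by
  rw [exitRate_openRate]
  refine ENNReal.add_ne_top.2 ⟨ne_top_of_le_ne_top (card_mul_rate_ne_top p q x.card)
    (tsum_hopRate_le p q x), ?_⟩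
  split_ifs <;> simp

section Closed

variable {s : ℂ} (hs : 0 < s.re)
include hs

theorem laplaceConverges_asepProb (x z : Config n) :
    LaplaceConverges (asepProb p q n x z) s :=
  laplaceConverges_transProb (r := hopConfig p q n) (exitRate_hopConfig_ne_top p q) hs z x

lemma tsum_enorm_asepKernel_le (y : Config n) :
    ∑' x, ‖asepKernel p q n s x y‖ₑ ≤ (ENNReal.ofReal s.re)⁻¹ :=
  tsum_enorm_laplace_transProb_le (r := hopConfig p q n) (exitRate_hopConfig_ne_top p q) hs y

lemma inv_re_ne_top : (ENNReal.ofReal s.re)⁻¹ ≠ ∞ :=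
  ENNReal.inv_ne_top.2 (ENNReal.ofReal_pos.2 hs).ne'

theorem hasKernel_L (n : ℕ) : HasKernel (L p q n s) (asepKernel p q n s) :=
  hasKernel_kernelOp (inv_re_ne_top hs) (tsum_enorm_asepKernel_le p q hs)

lemma norm_L_le (n : ℕ) : ‖L p q n s‖ ≤ s.re⁻¹ := by
  simpa [ENNReal.toReal_ofReal hs.le] using
    (hasKernel_L p q hs n).norm_le (inv_re_ne_top hs) (tsum_enorm_asepKernel_le p q hs)

/-- `L n s` is a right inverse of `s - H`, where `H` generates the closed `n`-particle process. -/
lemma solvesResolvent_L (F : E n) : SolvesResolvent (hopConfig p q n) s (L p q n s F) F :=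
  (hasKernel_L p q hs n).solvesResolvent (inv_re_ne_top hs) (tsum_enorm_asepKernel_le p q hs)
    (card_mul_rate_ne_top p q n) (exitRate_hopConfig_le p q)
    (fun y x => hasSum_laplace_forward (r := hopConfig p q n) (exitRate_hopConfig_ne_top p q)
      hs y x) F

lemma eq_L_of_solvesResolvent {F g : E n} (h : SolvesResolvent (hopConfig p q n) s F g) :
    F = L p q n s g :=
  SolvesResolvent.unique (card_mul_rate_ne_top p q n) (exitRate_hopConfig_le p q) hs h
    (solvesResolvent_L p q hs g)

end Closed

lemma deltaOp_apply (F : E n) (x : Config n) : deltaOp n F x = if 0 ∈ x.1 then F x else 0 := rfl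

lemma A_apply (F : E (n - 1)) (x : Config n) :
    A n F x = if h : 0 ∈ x.1 then F (tailConfig x h) else 0 := rfl

lemma A_zero : A 0 = 0 := by
  ext F x
  rw [A_apply, dif_neg]
  · rfl
  · simp [Finset.card_eq_zero.1 x.2]

lemma single_apply_config {k : ℕ} (y x : Config k) :
    (lp.single 1 y (1 : ℂ) : E k) x = if y.1 = x.1 then 1 else 0 := by
  by_cases h : x = y
  · subst h
    rw [lp.single_apply_self, if_pos rfl]
  · rw [lp.single_apply_ne _ _ _ h, if_neg fun h' => h (Subtype.ext h'.symm)]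

lemma norm_deltaOp_le (n : ℕ) : ‖deltaOp n‖ ≤ 1 :=
  LinearMap.mkContinuous_norm_le _ zero_le_one _

/-- A Neumann series, as `α * ‖L n s‖ ≤ α / Re s < 1`. -/
theorem isUnit_resolventOp {s : ℂ} (hs : (α : ℝ) < s.re) (n : ℕ) :
    IsUnit (resolventOp p q α 0 n s) := by
  have h0 : 0 < s.re := α.2.trans_lt hs
  refine isUnit_one_sub_of_norm_lt_one ?_
  calc _ ≤ (α : ℝ) * (s.re⁻¹ * 1) := by
        rw [norm_smul, NNReal.coe_zero, sub_zero, Complex.norm_real, Real.norm_of_nonneg α.coe_nonneg]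
        gcongr
        refine (norm_mul_le _ _).trans ?_
        gcongr
        exacts [norm_L_le p q h0 n, norm_deltaOp_le n]
    _ < 1 := by
        rw [mul_one, ← div_eq_mul_inv]
        exact (div_lt_one h0).2 hs

section Open

variable (y : Finset ℕ) {s : ℂ} (hs : (α : ℝ) < s.re)
include hs

lemma re_sub_pos : 0 < (s - (α : ℝ)).re := by simpa using hs

theorem laplaceConverges_openProb (x : Config n) :
    LaplaceConverges (openProb p q α 0 y n x) (s - (α : ℝ)) :=
  laplaceConverges_transProb (r := openRate p q α 0) (exitRate_openRate_ne_top p q α)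
    (re_sub_pos α hs) y x

lemma tsum_enorm_laplace_openProb_ne_top :
    ∑' x, ‖laplace (openProb p q α 0 y n x) (s - (α : ℝ))‖ₑ ≠ ∞ := by
  refine ne_top_of_le_ne_top (inv_re_ne_top (re_sub_pos α hs)) (le_trans ?_
    (tsum_enorm_laplace_transProb_le (r := openRate p q α 0) (exitRate_openRate_ne_top p q α)
      (re_sub_pos α hs) y))
  exact ENNReal.tsum_comp_le_tsum_of_injective Subtype.val_injective
    fun z => ‖laplace (fun t => transProb (openRate p q α 0) t y z) (s - (α : ℝ))‖ₑ

theorem Phat_apply (x : Config n) :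
    Phat p q α 0 y n (s - (α : ℝ)) x = laplace (openProb p q α 0 y n x) (s - (α : ℝ)) :=
  toE_apply (tsum_enorm_laplace_openProb_ne_top p q α y hs) x

/-- The forward equation of the open process on the `n`-particle sector.  Replacing the parameter
`s` by `s - α` turns the exit rate `α (1 - δ)` of injection into the perturbation `α δ`. -/
lemma solvesResolvent_Phat {f : E n} (hf : ∀ x, f x = if y = x.1 then 1 else 0) :
    SolvesResolvent (hopConfig p q n) s (Phat p q α 0 y n (s - (α : ℝ)))
      (f + ((α : ℝ) : ℂ) • deltaOp n (Phat p q α 0 y n (s - (α : ℝ))) +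
        ((α : ℝ) : ℂ) • A n (Phat p q α 0 y (n - 1) (s - (α : ℝ))) : E n) := by
  intro x
  set G : Finset ℕ → ℂ := fun z =>
    laplace (fun t => transProb (openRate p q α 0) t y z) (s - (α : ℝ)) with hG
  have hP : ∀ {m : ℕ} (z : Config m), Phat p q α 0 y m (s - (α : ℝ)) z = G z := fun z =>
    Phat_apply p q α y hs z
  have h1 : HasSum (fun z => ((openRate p q α 0 z x).toReal : ℂ) * G z)
      ((s - (α : ℝ) + (exitRate (openRate p q α 0) x.1).toReal) * G x -
        if y = x.1 then 1 else 0) :=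
    hasSum_laplace_forward (exitRate_openRate_ne_top p q α) (re_sub_pos α hs) y x
  have hne : ∀ z w, hopRate p q z w ≠ ∞ := fun z w =>
    ne_top_of_le_ne_top (card_mul_rate_ne_top p q z.card)
      ((ENNReal.le_tsum w).trans (tsum_hopRate_le p q z))
  have h2 : HasSum
      (fun z : Finset ℕ => (if 0 ∉ z ∧ x.1 = insert 0 z then ((α : ℝ) : ℂ) else 0) * G z)
      (if 0 ∈ x.1 then (α : ℝ) * G (x.1.erase 0) else 0) := by
    have h := hasSum_single (x.1.erase 0)
      (f := fun z : Finset ℕ => (if 0 ∉ z ∧ x.1 = insert 0 z then ((α : ℝ) : ℂ) else 0) * G z)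
      fun z hz => by
        rw [if_neg, zero_mul]
        rintro ⟨h0, hx⟩
        exact hz (by rw [hx, Finset.erase_insert h0])
    convert! h using 1
    by_cases h0 : 0 ∈ x.1
    · simp [h0, Finset.insert_erase h0]
    · have h' : x.1 ≠ insert 0 (x.1.erase 0) := fun h' => h0 (h' ▸ Finset.mem_insert_self _ _)
      rw [if_neg h0, if_neg fun h'' => h' h''.2, zero_mul]
  have h3 := h1.sub h2
  have h4 : (fun z : Finset ℕ => ((openRate p q α 0 z x).toReal : ℂ) * G z -
      (if 0 ∉ z ∧ x.1 = insert 0 z then ((α : ℝ) : ℂ) else 0) * G z) =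
      fun z => ((hopRate p q z x).toReal : ℂ) * G z := by
    ext z
    rw [openRate_zero, ENNReal.toReal_add (hne z x) (by split_ifs <;> simp)]
    split_ifs <;> simp [add_mul]
  rw [h4, ← (Subtype.val_injective (p := fun z : Finset ℕ => z.card = n)).hasSum_iff] at h3
  · convert! h3 using 1
    · ext z
      simp only [Function.comp_apply, ← hP]
    · rw [exitRate_openRate, ENNReal.toReal_add (ne_top_of_le_ne_top
        (card_mul_rate_ne_top p q _) (tsum_hopRate_le p q x.1)) (by split_ifs <;> simp),
        ← exitRate_hopConfig]
      simp only [lp.coeFn_add, lp.coeFn_smul, Pi.add_apply, Pi.smul_apply, smul_eq_mul, hf,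
        deltaOp_apply, A_apply, hP, tailConfig]
      by_cases h0 : 0 ∈ x.1
      · simp [h0]
        ring
      · simp [h0]
  · intro z hz
    by_contra h
    refine hz ⟨⟨z, ?_⟩, rfl⟩
    rw [← x.2]
    refine (card_eq_of_hopRate_ne_zero p q fun h' => h ?_).symm
    rw [h', ENNReal.toReal_zero, Complex.ofReal_zero, zero_mul]

/-- The recursion between particle numbers, with the initial configuration as source `f`. -/
lemma Phat_eq {f : E n} (hf : ∀ x, f x = if y = x.1 then 1 else 0) :
    Phat p q α 0 y n (s - (α : ℝ)) = M p q α 0 n s (L p q n s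
      (f + ((α : ℝ) : ℂ) • A n (Phat p q α 0 y (n - 1) (s - (α : ℝ))))) := by
  have h := eq_L_of_solvesResolvent p q (α.2.trans_lt hs) (solvesResolvent_Phat p q α y hs hf)
  set P := Phat p q α 0 y n (s - (α : ℝ))
  have h1 : resolventOp p q α 0 n s P =
      L p q n s (f + ((α : ℝ) : ℂ) • A n (Phat p q α 0 y (n - 1) (s - (α : ℝ)))) := by
    have h2 : resolventOp p q α 0 n s P = P - ((α : ℝ) : ℂ) • L p q n s (deltaOp n P) := by
      rw [resolventOp, NNReal.coe_zero, sub_zero]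
      rfl
    rw [h2]
    nth_rw 1 [h]
    simp only [map_add, map_smul]
    abel
  rw [← h1]
  exact (DFunLike.congr_fun (Ring.inverse_mul_cancel _ (isUnit_resolventOp p q α hs n)) P).symm

lemma Phat_eq_of_ne (hn : y.card ≠ n) :
    Phat p q α 0 y n (s - (α : ℝ)) = ((α : ℝ) : ℂ) • M p q α 0 n s (L p q n s
      (A n (Phat p q α 0 y (n - 1) (s - (α : ℝ))))) := by
  have h := Phat_eq p q α y hs (n := n) (f := 0) fun x => by
    rw [if_neg fun h => hn (by rw [h, x.2])]
    rfl
  rw [zero_add, map_smul, map_smul] at h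
  exact h

/-- Without ejection the number of particles never drops below its initial value. -/
lemma Phat_eq_zero (hn : n < y.card) : Phat p q α 0 y n (s - (α : ℝ)) = 0 := by
  induction n with
  | zero => rw [Phat_eq_of_ne p q α y hs hn.ne', A_zero]; simp
  | succ n ih =>
    have h : Phat p q α 0 y (n + 1 - 1) (s - (α : ℝ)) = 0 := ih (by omega)
    rw [Phat_eq_of_ne p q α y hs hn.ne', h]
    simp

lemma A_Phat_card {k : ℕ} (y : Config k) : A k (Phat p q α 0 y (k - 1) (s - (α : ℝ))) = 0 := by
  rcases Nat.eq_zero_or_pos k with rfl | hk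
  · rw [A_zero]; rfl
  · rw [Phat_eq_zero p q α y hs (by rw [y.2]; omega), map_zero]

/-- The empty system only waits for an injection. -/
lemma Phat_empty {k : ℕ} (y : Config k) (hk : k = 0) (x : Config k) :
    Phat p q α 0 y k (s - (α : ℝ)) x = s⁻¹ := by
  subst hk
  have hx : x.1 = ∅ := Finset.card_eq_zero.1 x.2
  have hy : y.1 = x.1 := (Finset.card_eq_zero.1 y.2).trans hx.symm
  have h0 : ∀ z : Config 0, hopConfig p q 0 z x = 0 := fun z => by
    simp [hopConfig, hopRate, Finset.card_eq_zero.1 z.2]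
  have he : exitRate (hopConfig p q 0) x = 0 := by
    simpa using exitRate_hopConfig_le p q x
  have hs0 : s ≠ 0 := by
    rintro rfl
    exact absurd (α.2.trans_lt hs) (by simp)
  have h := (solvesResolvent_Phat p q α y hs (single_apply_config y) x).unique
    (by simp only [h0, ENNReal.toReal_zero, Complex.ofReal_zero, zero_mul]; exact hasSum_zero)
  rw [A_Phat_card p q α hs y] at h
  generalize hc : Phat p q α 0 y 0 (s - (α : ℝ)) x = c at h ⊢
  simp only [lp.coeFn_add, lp.coeFn_smul, Pi.add_apply, Pi.smul_apply, single_apply_config, hy,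
    deltaOp_apply, hx, he] at h
  simp at h
  exact eq_inv_of_mul_eq_one_right (sub_eq_zero.1 h)

end Open

end OpenASEP

theorem corollary1p1 (p q α : ℝ≥0) (hpq : p + q = 1) (k : ℕ) (y : OpenASEP.Config k)
    (s : ℂ) (hs : (α : ℝ) < s.re) :
    -- the Laplace integrals converge, and the functions `P̂_n(s - α)` are in `E n`
    (∀ (n : ℕ) (x z : OpenASEP.Config n),
      OpenASEP.LaplaceConverges (OpenASEP.asepProb p q n x z) s) ∧
    (∀ (n : ℕ) (x : OpenASEP.Config n),
      OpenASEP.LaplaceConverges (OpenASEP.openProb p q α 0 y n x) (s - (α : ℝ))) ∧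
    (∀ (n : ℕ) (x : OpenASEP.Config n),
      OpenASEP.Phat p q α 0 y n (s - (α : ℝ)) x =
        OpenASEP.laplace (OpenASEP.openProb p q α 0 y n x) (s - (α : ℝ))) ∧
    -- the operators `L_n(s)` exist, and the inverses `M_n(s)` exist
    (∀ n : ℕ, OpenASEP.HasKernel (OpenASEP.L p q n s) (OpenASEP.asepKernel p q n s)) ∧
    (∀ n : ℕ, IsUnit (OpenASEP.resolventOp p q α 0 n s)) ∧
    -- the formula for `k` particles, and its value for `k = 0`
    OpenASEP.Phat p q α 0 y k (s - (α : ℝ)) =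
      OpenASEP.M p q α 0 k s (OpenASEP.L p q k s (lp.single 1 y (1 : ℂ))) ∧
    (k = 0 → ∀ x : OpenASEP.Config k,
      OpenASEP.Phat p q α 0 y k (s - (α : ℝ)) x = s⁻¹) ∧
    -- the recursion for more than `k` particles
    (∀ n : ℕ, k < n →
      OpenASEP.Phat p q α 0 y n (s - (α : ℝ)) =
        ((α : ℝ) : ℂ) • OpenASEP.M p q α 0 n s (OpenASEP.L p q n s
          (OpenASEP.A n (OpenASEP.Phat p q α 0 y (n - 1) (s - (α : ℝ)))))) := by
  open OpenASEP in
  have h0 : 0 < s.re := α.2.trans_lt hs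
  refine ⟨fun n x z => laplaceConverges_asepProb p q h0 x z,
    fun n x => laplaceConverges_openProb p q α y hs x,
    fun n x => Phat_apply p q α y hs x,
    hasKernel_L p q h0, isUnit_resolventOp p q α hs, ?_,
    fun hk x => Phat_empty p q α hs y hk x,
    fun n hn => Phat_eq_of_ne p q α y hs (by rw [y.2]; exact hn.ne)⟩
  have h := Phat_eq p q α y hs (single_apply_config y)
  rw [A_Phat_card p q α hs y, smul_zero, add_zero] at h
  exact h
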